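/- Let $D\ge 1$ be a real number, and let $(\mathbb G_n)_{n\ge 1}$, $\mathbb G_n=(V_n,E_n)$, be a sequence of finite simple undirected graphs all of whose degrees are at most $D$. Write $u\sim v$ if $u,v$ are joined by an edge. **Large deviations principle.** A sequence of Borel probability measures $\mathbb P_n$ on a metric space $S$ satisfies the LDP with normalization $\theta_n$ if $\theta_n>0$ for all $n$, $\theta_n\to\infty$, and there is a lower semicontinuous function $I:S\to[0,\infty]$ such that for every Borel set $A\subset S$ $$-\inf_{x\in A^\circ}I(x)\le\liminf_{n}\frac{\log \mathbb P_n(A^\circ)}{\theta_n}\quad\text{and}\quad\limsup_n\frac{\log\mathbb P_n(\bar A)}{\theta_n}\le-\inf_{x\in\bar A}I(x),$$ where $A^\circ$ and $\bar A$ are the interior and the closure of $A$, $\log 0=-\infty$ and $\inf\emptyset=+\infty$. **LD-convergence.** For $d=1,2$ let $\mathcal M^d$ be the space of Borel measures on $[0,1]^d$ of total mass at most $D$, with the Prokhorov metric (with respect to the $\ell_\infty$ distance on $[0,1]^d$), and give $\mathcal M^1\times\mathcal M^2$ the maximum of the two metrics. For $\sigma:V_n\to[0,1]$ put $$\rho(\sigma)=\sum_{u\in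 V_n}\frac1{|V_n|}\delta_{\sigma(u)}\in\mathcal M^1,\qquad \mu(\sigma)=\sum_{(u,v)\in V_n\times V_n:\ u\sim v}\frac1{|V_n|}\delta_{(\sigma(u),\sigma(v))}\in\mathcal M^2 .$$ The sequence $(\mathbb G_n)$ is *LD-convergent* if, with $\sigma_n(u)$, $u\in V_n$, i.i.d. uniform on $[0,1]$, the laws of $(\rho(\sigma_n),\mu(\sigma_n))$ satisfy the LDP in $\mathcal M^1\times\mathcal M^2$ with normalization $\theta_n=|V_n|$. **$k$-LD-convergence.** Let $k\ge1$ be an integer. For $\sigma:V_n\to\{1,\dots,k\}$ and $1\le i,j\le k$ put $$x_i(\sigma)=\frac{|\sigma^{-1}(i)|}{|V_n|},\qquad X_{ij}(\sigma)=\frac{|\{(u,v)\in V_n\times V_n:\ u\sim v,\ \sigma(u)=i,\ \sigma(v)=j\}|}{|V_n|},$$ so that $(x(\sigma),X(\sigma))\in[0,D]^{(k+1)\times k}$, a space which carries the $\ell_\infty$ metric. The sequence $(\mathbb G_n)$ is *$k$-LD-convergent* if, with $\sigma_n:V_n\to\{1,\dots,k\}$ chosen uniformly at random among all maps, the laws of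 $(x(\sigma_n),X(\sigma_n))$ satisfy the LDP in $[0,D]^{(k+1)\times k}$ with normalization $\theta_n=|V_n|$. **Theorem.** The sequence $(\mathbb G_n)$ is LD-convergent if and only if it is $k$-LD-convergent for every integer $k\ge1$. -/

import Mathlib

open MeasureTheory Filter Topology Set
open scoped NNReal ENNReal

noncomputable section

namespace LDGraph

/-! ### Large deviations principle -/

/-- The laws `P n` on the (topological) space `S` satisfy the large deviations principle with
normalization `θ n > 0`, `θ n → ∞`, and some lower semicontinuous rate function
`I : S → [0, ∞]`. Here `log 0 = -∞` and the infimum over the empty set is `+∞`. -/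
def SatisfiesLDP {S : Type*} [TopologicalSpace S] [MeasurableSpace S]
    (P : ℕ → Measure S) (θ : ℕ → ℝ) : Prop :=
  (∀ n, 0 < θ n) ∧ Tendsto θ atTop atTop ∧
    ∃ I : S → ℝ≥0∞, LowerSemicontinuous I ∧
      ∀ A : Set S, MeasurableSet A →
        -((⨅ x ∈ interior A, I x : ℝ≥0∞) : EReal) ≤
            liminf (fun n => ENNReal.log (P n (interior A)) / ((θ n : ℝ) : EReal)) atTop ∧
        limsup (fun n => ENNReal.log (P n (closure A)) / ((θ n : ℝ) : EReal)) atTop ≤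
            -((⨅ x ∈ closure A, I x : ℝ≥0∞) : EReal)

/-! ### Spaces of measures with the Prokhorov metric -/

/-- The finite measures on `Ω` of total mass at most `D`, with the Prokhorov metric. -/
abbrev BoundedMeasure (Ω : Type*) [MeasurableSpace Ω] (D : ℝ≥0) : Type _ :=
  {μ : LevyProkhorov (FiniteMeasure Ω) // μ.toMeasure.mass ≤ D}

/-- Pairs of measures on `[0,1]` and on `[0,1]²`, both of total mass at most `D`. The distance of
two pairs is the maximum of the two Prokhorov distances; `[0,1]²` carries the sup distance. -/
def MeasurePair (D : ℝ≥0) : Type :=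
  BoundedMeasure unitInterval D × BoundedMeasure (unitInterval × unitInterval) D

instance (D : ℝ≥0) : PseudoMetricSpace (MeasurePair D) :=
  inferInstanceAs (PseudoMetricSpace (BoundedMeasure unitInterval D × BoundedMeasure (unitInterval × unitInterval) D))

instance (D : ℝ≥0) : MeasurableSpace (MeasurePair D) := borel _

instance (D : ℝ≥0) : BorelSpace (MeasurePair D) := ⟨rfl⟩

/-- The measure that puts mass `c` on each of the points `f i`, i.e. `∑ i, c • δ_{f i}`. -/
def atomicMeasure {ι Ω : Type*} [Fintype ι] [MeasurableSpace Ω] (c : ℝ≥0) (f : ι → Ω) :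
    FiniteMeasure Ω :=
  ∑ i, c • (diracProba (f i)).toFiniteMeasure

lemma atomicMeasure_toMeasure {ι Ω : Type*} [Fintype ι] [MeasurableSpace Ω] (c : ℝ≥0)
    (f : ι → Ω) :
    (atomicMeasure c f : Measure Ω) = ∑ i, c • Measure.dirac (f i) := by
  simp [atomicMeasure, FiniteMeasure.toMeasure_sum, FiniteMeasure.toMeasure_smul, diracProba]
  rfl

lemma atomicMeasure_mass {ι Ω : Type*} [Fintype ι] [MeasurableSpace Ω] (c : ℝ≥0) (f : ι → Ω) :
    (atomicMeasure c f).mass = Fintype.card ι * c := by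
  have h : ((atomicMeasure c f).mass : ℝ≥0∞) = ((Fintype.card ι * c : ℝ≥0) : ℝ≥0∞) := by
    rw [FiniteMeasure.ennreal_mass, atomicMeasure_toMeasure]
    simp [Measure.finsetSum_apply]
  exact_mod_cast h

/-- Moving the atoms by at most `δ` moves the measure by at most `δ` in Prokhorov distance. -/
lemma dist_atomicMeasure_le {ι Ω : Type*} [Fintype ι] [MeasurableSpace Ω] [PseudoMetricSpace Ω]
    [OpensMeasurableSpace Ω] (c : ℝ≥0) (f g : ι → Ω) :
    dist (LevyProkhorov.ofMeasure (atomicMeasure c f)) (LevyProkhorov.ofMeasure (atomicMeasure c g))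
      ≤ dist f g := by
  have key : ∀ (f g : ι → Ω) (ε : ℝ) (B : Set Ω), dist f g < ε → MeasurableSet B →
      (atomicMeasure c f : Measure Ω) B ≤
        (atomicMeasure c g : Measure Ω) (Metric.thickening ε B) + ENNReal.ofReal ε := by
    intro f g ε B hε hB
    refine le_trans ?_ le_self_add
    rw [atomicMeasure_toMeasure, atomicMeasure_toMeasure, Measure.finsetSum_apply,
      Measure.finsetSum_apply]
    refine Finset.sum_le_sum fun i _ => ?_
    rw [Measure.smul_apply, Measure.smul_apply, Measure.dirac_apply' _ hB,
      Measure.dirac_apply' _ Metric.isOpen_thickening.measurableSet]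
    by_cases hi : f i ∈ B
    · have : g i ∈ Metric.thickening ε B :=
        Metric.mem_thickening_iff.2 ⟨f i, hi, by
          rw [dist_comm]; exact (dist_le_pi_dist f g i).trans_lt hε⟩
      simp [hi, this]
    · simp [hi]
  rw [LevyProkhorov.dist_finiteMeasure_def]
  refine ENNReal.toReal_le_of_le_ofReal dist_nonneg ?_
  refine levyProkhorovEDist_le_of_forall _ _ _ fun ε B h1 h2 hB => ?_
  have hε : dist f g < ε.toReal := (ENNReal.ofReal_lt_iff_lt_toReal dist_nonneg h2.ne).1 h1
  have e : ENNReal.ofReal ε.toReal = ε := ENNReal.ofReal_toReal h2.ne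
  constructor
  · simpa only [e] using key f g ε.toReal B hε hB
  · simpa only [e] using key g f ε.toReal B (by rwa [dist_comm]) hB

/-! ### Graphs with `[0,1]`-labels -/

section Graph

variable {V : Type*} [Fintype V] (G : SimpleGraph V) [DecidableRel G.Adj] {D : ℝ≥0}

lemma card_dart_le (hdeg : ∀ v, (G.degree v : ℝ≥0) ≤ D) :
    (Fintype.card G.Dart : ℝ≥0) * (Fintype.card V : ℝ≥0)⁻¹ ≤ D := by
  classical
  rcases isEmpty_or_nonempty V with h | h
  · simp
  rw [← div_eq_mul_inv, div_le_iff₀ (by positivity), G.dart_card_eq_sum_degrees]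
  push_cast
  calc ∑ v, (G.degree v : ℝ≥0) ≤ ∑ _v : V, D := Finset.sum_le_sum fun v _ => hdeg v
    _ = D * Fintype.card V := by simp [mul_comm]

/-- The pair `(ρ(σ), μ(σ))` attached to a labelling `σ : V → [0,1]`: `ρ(σ)` puts mass `1/|V|` on
`σ u` for each node `u`, and `μ(σ)` puts mass `1/|V|` on `(σ u, σ v)` for each oriented edge
`(u, v)`. -/
def measurePair (hD : 1 ≤ D) (hdeg : ∀ v, (G.degree v : ℝ≥0) ≤ D) (σ : V → unitInterval) : MeasurePair D :=
  (⟨.ofMeasure (atomicMeasure (Fintype.card V : ℝ≥0)⁻¹ fun u : V => σ u), by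
      rw [atomicMeasure_mass]
      exact (mul_inv_le_one).trans hD⟩,
   ⟨.ofMeasure (atomicMeasure (Fintype.card V : ℝ≥0)⁻¹ fun e : G.Dart => (σ e.fst, σ e.snd)), by
      rw [atomicMeasure_mass]
      exact card_dart_le G hdeg⟩)

lemma continuous_measurePair (hD : 1 ≤ D) (hdeg : ∀ v, (G.degree v : ℝ≥0) ≤ D) :
    Continuous (measurePair G hD hdeg) := by
  refine LipschitzWith.continuous (K := 1) (LipschitzWith.of_dist_le_mul fun σ τ => ?_)
  rw [NNReal.coe_one, one_mul]
  refine max_le (dist_atomicMeasure_le _ _ _) ((dist_atomicMeasure_le _ _ _).trans ?_)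
  refine (dist_pi_le_iff dist_nonneg).2 fun e => ?_
  exact max_le (dist_le_pi_dist σ τ e.fst) (dist_le_pi_dist σ τ e.snd)

/-- The law of `(ρ(σ), μ(σ))` when the labels `σ u`, `u ∈ V`, are i.i.d. uniform on `[0,1]`
(`volume` on `V → [0,1]` is the product of the Lebesgue measures). -/
def measurePairLaw (hD : 1 ≤ D) (hdeg : ∀ v, (G.degree v : ℝ≥0) ≤ D) : Measure (MeasurePair D) :=
  (volume : Measure (V → unitInterval)).map (measurePair G hD hdeg)

lemma isProbabilityMeasure_measurePairLaw (hD : 1 ≤ D) (hdeg : ∀ v, (G.degree v : ℝ≥0) ≤ D) :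
    IsProbabilityMeasure (measurePairLaw G hD hdeg) :=
  Measure.isProbabilityMeasure_map (continuous_measurePair G hD hdeg).measurable.aemeasurable

/-! ### Quotients of graphs -/

variable (D) in
/-- The space `[0,D]^{(k+1)×k}` of pairs `(x, X)`, `x ∈ [0,D]^k`, `X ∈ [0,D]^{k×k}`, with the
distance `max (max_i |x_i - y_i|) (max_{i,j} |X_{ij} - Y_{ij}|)`. -/
abbrev QuotientSpace (k : ℕ) : Type :=
  (Fin k → Icc (0 : ℝ) D) × (Fin k → Fin k → Icc (0 : ℝ) D)

/-- The `k`-quotient `(x(σ), X(σ))` of a coloring `σ : V → [k]`: `x_i` is the number of nodes of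
color `i` and `X_{ij}` the number of ordered pairs `(u, v)` with `u ∼ v`, `σ u = i`, `σ v = j`,
both divided by `|V|`. -/
def quotient (hD : 1 ≤ D) (hdeg : ∀ v, (G.degree v : ℝ≥0) ≤ D) {k : ℕ} (σ : V → Fin k) :
    QuotientSpace D k :=
  (fun i => ⟨(Fintype.card {u : V // σ u = i} : ℝ) / Fintype.card V, by positivity, by
      refine le_trans (div_le_one_of_le₀ ?_ (by positivity)) (by exact_mod_cast hD)
      exact_mod_cast Fintype.card_subtype_le _⟩,
   fun i j => ⟨(Fintype.card {e : G.Dart // σ e.fst = i ∧ σ e.snd = j} : ℝ) / Fintype.card V,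
    by positivity, by
      have h : (Fintype.card G.Dart : ℝ) / Fintype.card V ≤ D := by
        rw [div_eq_mul_inv]
        exact_mod_cast card_dart_le G hdeg
      refine le_trans (div_le_div_of_nonneg_right ?_ (by positivity)) h
      exact_mod_cast Fintype.card_subtype_le _⟩)

/-- The law of the `k`-quotient `(x(σ), X(σ))` of a uniformly random coloring `σ : V → [k]`. -/
def quotientLaw (hD : 1 ≤ D) (hdeg : ∀ v, (G.degree v : ℝ≥0) ≤ D) (k : ℕ) :
    Measure (QuotientSpace D k) :=
  (ProbabilityTheory.uniformOn (univ : Set (V → Fin k))).map (quotient G hD hdeg)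

lemma isProbabilityMeasure_quotientLaw (hD : 1 ≤ D) (hdeg : ∀ v, (G.degree v : ℝ≥0) ≤ D) (k : ℕ)
    (hk : 1 ≤ k) : IsProbabilityMeasure (quotientLaw G hD hdeg k) := by
  have : Nonempty (Fin k) := ⟨⟨0, hk⟩⟩
  have : IsProbabilityMeasure (ProbabilityTheory.uniformOn (univ : Set (V → Fin k))) :=
    ProbabilityTheory.isProbabilityMeasure_uniformOn finite_univ univ_nonempty
  exact Measure.isProbabilityMeasure_map (measurable_of_finite _).aemeasurable

end Graph

/-! ### Convergence of graph sequences of degree at most `D` -/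

section Convergence

variable {V : ℕ → Type*} [∀ n, Fintype (V n)] (G : ∀ n, SimpleGraph (V n))
  [∀ n, DecidableRel (G n).Adj] {D : ℝ≥0}

/-- LD-convergence: the random pairs of measures `(ρ(σ_n), μ(σ_n))` satisfy the LDP with
normalization `|V_n|`. -/
def LDConvergent (hD : 1 ≤ D) (hdeg : ∀ n v, ((G n).degree v : ℝ≥0) ≤ D) : Prop :=
  SatisfiesLDP (fun n => measurePairLaw (G n) hD (hdeg n)) (fun n => (Fintype.card (V n) : ℝ))

/-- `k`-LD-convergence: the random `k`-quotients `(x(σ_n), X(σ_n))` satisfy the LDP with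
normalization `|V_n|`. -/
def KLDConvergent (hD : 1 ≤ D) (hdeg : ∀ n v, ((G n).degree v : ℝ≥0) ≤ D) (k : ℕ) : Prop :=
  SatisfiesLDP (fun n => quotientLaw (G n) hD (hdeg n) k) (fun n => (Fintype.card (V n) : ℝ))

end Convergence

end LDGraph

end

/-!
Both implications are instances of one principle, `satisfiesLDP_of_approx`: on a compact space `S`,
random elements `Z n` satisfy an LDP as soon as, for every `ε > 0` and every `M`, there are
continuous images `W n` of random elements satisfying some LDP such that `dist (Z n) (W n) > ε` has
exponential rate at most `M`. On a compact space an LDP only asks that the upper and the lower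
exponential rates of small balls agree in the limit (`satisfiesLDP_of_ball`). For `W n` this
agreement follows from the two bounds of the given LDP, applied to preimages of balls, and it passes
to `Z n` because events of rate below that of the ball under consideration can be ignored. No
tightness or contraction principle for the approximating spaces is needed.

To apply this, the labels `σ u`, i.i.d. uniform on `[0,1]`, serve as a common source of randomness:
sorting them into the `k` cells `[i/k, (i+1)/k)` gives a uniformly random coloring
(`uniformOn_univ_eq_map_cell`).

* From `k`-LD-convergence to LD-convergence: placing the masses of the quotient on the points `i/k`
  and `(i/k, j/k)` is continuous, and it recovers the pair of measures up to distance `1/k`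
  (`dist_nodeMeasurePair_quotient_le`).
* From LD-convergence to `k`-LD-convergence: the indicator functions of the cells agree with
  continuous functions `φ i` outside of a set `N` of measure at most `η`. Integrating the `φ i` is
  continuous in the pair of measures, and since degrees are at most `D`, it recovers the quotient up
  to `2 D` times the proportion of labels in `N` (`dist_smoothQuotient_le`). This proportion exceeds
  `t` with probability at most `(2 η ^ t) ^ |V|` (`volume_card_lt_le`), whose rate tends to `-∞` as
  `η → 0`.

The space of pairs of measures is compact because on a compact space the Prokhorov metric induces
the weak topology on measures of bounded mass (`boundedMeasureHomeomorph`), for which compactness is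
known.
-/

namespace LDGraph

/-! ### Exponential rates -/

/-- The upper exponential rate `limsup (log (u n)) / θ n` of a sequence in `[0, ∞]`. -/
noncomputable def upperRate (θ : ℕ → ℝ) (u : ℕ → ℝ≥0∞) : EReal :=
  limsup (fun n => ENNReal.log (u n) / ((θ n : ℝ) : EReal)) atTop

/-- The lower exponential rate `liminf (log (u n)) / θ n` of a sequence in `[0, ∞]`. -/
noncomputable def lowerRate (θ : ℕ → ℝ) (u : ℕ → ℝ≥0∞) : EReal :=
  liminf (fun n => ENNReal.log (u n) / ((θ n : ℝ) : EReal)) atTop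

section Rates

variable {θ : ℕ → ℝ} {u v : ℕ → ℝ≥0∞}

lemma log_div_mono (hθ : ∀ n, 0 < θ n) {n : ℕ} {a b : ℝ≥0∞} (h : a ≤ b) :
    ENNReal.log a / ((θ n : ℝ) : EReal) ≤ ENNReal.log b / ((θ n : ℝ) : EReal) :=
  EReal.div_le_div_right_of_nonneg (by exact_mod_cast (hθ n).le) (ENNReal.log_le_log h)

lemma upperRate_mono (hθ : ∀ n, 0 < θ n) (h : ∀ n, u n ≤ v n) :
    upperRate θ u ≤ upperRate θ v :=
  limsup_le_limsup (Eventually.of_forall fun _ => log_div_mono hθ (h _))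

lemma lowerRate_mono (hθ : ∀ n, 0 < θ n) (h : ∀ n, u n ≤ v n) :
    lowerRate θ u ≤ lowerRate θ v :=
  liminf_le_liminf (Eventually.of_forall fun _ => log_div_mono hθ (h _))

lemma lowerRate_le_upperRate : lowerRate θ u ≤ upperRate θ u := liminf_le_limsup

lemma upperRate_nonpos (hθ : ∀ n, 0 < θ n) (h : ∀ n, u n ≤ 1) : upperRate θ u ≤ 0 := by
  refine (upperRate_mono hθ (v := fun _ => 1) h).trans ?_
  simp [upperRate]

lemma upperRate_zero (hθ : ∀ n, 0 < θ n) : upperRate θ (fun _ => 0) = ⊥ := by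
  have : ∀ n, (⊥ : EReal) / ((θ n : ℝ) : EReal) = ⊥ := fun n =>
    EReal.bot_div_of_pos_ne_top (by exact_mod_cast hθ n) (EReal.coe_ne_top _)
  simp [upperRate, this]

lemma log_add_div_le (hθ : ∀ n, 0 < θ n) (n : ℕ) :
    ENNReal.log (u n + v n) / ((θ n : ℝ) : EReal) ≤
      ENNReal.log 2 / ((θ n : ℝ) : EReal) +
        max (ENNReal.log (u n) / ((θ n : ℝ) : EReal)) (ENNReal.log (v n) / ((θ n : ℝ) : EReal)) := by
  have h : u n + v n ≤ 2 * max (u n) (v n) := by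
    rw [two_mul]; exact add_le_add (le_max_left _ _) (le_max_right _ _)
  refine (log_div_mono hθ h).trans ?_
  have h0 : (0 : EReal) ≤ ((θ n : ℝ) : EReal) := by exact_mod_cast (hθ n).le
  have hmax : max (ENNReal.log (u n) / ((θ n : ℝ) : EReal)) (ENNReal.log (v n) / ((θ n : ℝ) : EReal))
      = ENNReal.log (max (u n) (v n)) / ((θ n : ℝ) : EReal) := by
    have hm : Monotone fun a : ℝ≥0∞ => ENNReal.log a / ((θ n : ℝ) : EReal) :=
      fun a b h => log_div_mono hθ h
    exact (hm.map_max).symm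
  rw [hmax, ENNReal.log_mul_add, EReal.div_eq_inv_mul, EReal.div_eq_inv_mul, EReal.div_eq_inv_mul,
    EReal.left_distrib_of_nonneg_of_ne_top]
  · exact EReal.inv_nonneg_of_nonneg h0
  · rw [← EReal.coe_inv]; exact EReal.coe_ne_top _

lemma tendsto_log_two_div (hlim : Tendsto θ atTop atTop) :
    Tendsto (fun n => ENNReal.log 2 / ((θ n : ℝ) : EReal)) atTop (𝓝 0) := by
  have h2 : ENNReal.log 2 = ((Real.log 2 : ℝ) : EReal) := by
    rw [ENNReal.log_pos_real (by simp) (by simp)]; simp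
  have : Tendsto (fun n => ((Real.log 2 / θ n : ℝ) : EReal)) atTop (𝓝 ((0 : ℝ) : EReal)) :=
    (continuous_coe_real_ereal.tendsto _).comp (hlim.const_div_atTop _)
  simpa [h2, EReal.coe_div] using this

lemma upperRate_add_le (hθ : ∀ n, 0 < θ n) (hlim : Tendsto θ atTop atTop) :
    upperRate θ (fun n => u n + v n) ≤ max (upperRate θ u) (upperRate θ v) := by
  have h2 := (tendsto_log_two_div hlim).limsup_eq
  refine (limsup_le_limsup (Eventually.of_forall fun n => log_add_div_le hθ n)).trans ?_
  refine (EReal.limsup_add_le (.inl (by rw [h2]; simp)) (.inl (by rw [h2]; simp))).trans ?_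
  rw [h2, zero_add, limsup_max]
  rfl

/-- A summand of small upper rate does not affect the lower rate of a sum. -/
lemma lowerRate_add_le (hθ : ∀ n, 0 < θ n) (hlim : Tendsto θ atTop atTop) :
    lowerRate θ (fun n => u n + v n) ≤ max (lowerRate θ u) (upperRate θ v) := by
  have h2 := (tendsto_log_two_div hlim).limsup_eq
  refine (liminf_le_liminf (Eventually.of_forall fun n => log_add_div_le hθ n)).trans ?_
  refine (EReal.liminf_add_le (.inl (by rw [h2]; simp)) (.inl (by rw [h2]; simp))).trans ?_
  rw [h2, zero_add]
  refine le_of_forall_gt fun c hc => ?_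
  obtain ⟨d, hd, hdc⟩ := exists_between hc
  have hu := frequently_lt_of_liminf_lt (by isBoundedDefault) ((le_max_left _ _).trans_lt hd)
  have hv := eventually_lt_of_limsup_lt ((le_max_right _ _).trans_lt hd)
  refine lt_of_le_of_lt (liminf_le_of_frequently_le (a := d) ?_) hdc
  exact (hu.and_eventually hv).mono fun n hn => (max_lt hn.1 hn.2).le

end Rates

/-! ### Large deviations on compact spaces -/

section Compact

variable {S : Type*} [PseudoMetricSpace S] [MeasurableSpace S]

/-- The rate function of a sequence of measures: minus the limit of the lower exponential rates of
small balls. -/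
noncomputable def localRate (P : ℕ → Measure S) (θ : ℕ → ℝ) (z : S) : ℝ≥0∞ :=
  ⨆ δ : {δ : ℝ // 0 < δ}, (-lowerRate θ fun n => P n (Metric.ball z δ)).toENNReal

lemma lowerSemicontinuous_localRate (P : ℕ → Measure S) {θ : ℕ → ℝ} (hθ : ∀ n, 0 < θ n) :
    LowerSemicontinuous (localRate P θ) := by
  intro z c hc
  obtain ⟨⟨δ, hδ⟩, hc⟩ := lt_iSup_iff.1 hc
  filter_upwards [Metric.ball_mem_nhds z (half_pos hδ)] with w hw
  refine hc.trans_le (le_trans ?_ (le_iSup _ ⟨δ / 2, half_pos hδ⟩))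
  refine EReal.toENNReal_le_toENNReal (EReal.neg_le_neg_iff.2 ?_)
  refine lowerRate_mono hθ fun n => measure_mono (Metric.ball_subset_ball' ?_)
  have := Metric.mem_ball.1 hw
  simp only
  linarith

/-- On a compact space the LDP holds as soon as the upper and the lower exponential rates of the
balls around each point agree in the limit of vanishing radius. -/
theorem satisfiesLDP_of_ball [CompactSpace S] {P : ℕ → Measure S}
    [∀ n, IsProbabilityMeasure (P n)] {θ : ℕ → ℝ}
    (hθ : ∀ n, 0 < θ n) (hlim : Tendsto θ atTop atTop)
    (h : ∀ (z : S) (c : EReal),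
      (∀ ε > 0, c ≤ upperRate θ fun n => P n (Metric.ball z ε)) →
        ∀ δ > 0, c ≤ lowerRate θ fun n => P n (Metric.ball z δ)) :
    SatisfiesLDP P θ := by
  refine ⟨hθ, hlim, localRate P θ, lowerSemicontinuous_localRate P hθ, fun A _ => ⟨?_, ?_⟩⟩
  · change _ ≤ lowerRate θ fun n => P n (interior A)
    set L := lowerRate θ fun n => P n (interior A)
    have hL0 : 0 ≤ -L := by
      rw [EReal.le_neg, neg_zero]
      exact lowerRate_le_upperRate.trans (upperRate_nonpos hθ fun n => prob_le_one)
    rw [EReal.neg_le, ← EReal.coe_toENNReal hL0, EReal.coe_ennreal_le_coe_ennreal_iff]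
    refine le_iInf₂ fun z hz => ?_
    obtain ⟨δ, hδ, hsub⟩ := Metric.isOpen_iff.1 isOpen_interior z hz
    refine le_trans ?_ (le_iSup _ ⟨δ, hδ⟩)
    exact EReal.toENNReal_le_toENNReal
      (EReal.neg_le_neg_iff.2 (lowerRate_mono hθ fun n => measure_mono hsub))
  · change (upperRate θ fun n => P n (closure A)) ≤ _
    refine le_of_forall_gt_imp_ge_of_dense fun c hc => ?_
    rcases lt_or_ge 0 c with hc0 | hc0
    · exact (upperRate_nonpos hθ fun n => prob_le_one).trans hc0.le
    -- Sets of upper rate at most `c` are stable under finite unions, so by compactness it suffices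
    -- to find one around each point.
    refine IsCompact.induction_on (p := fun s => (upperRate θ fun n => P n s) ≤ c)
      isClosed_closure.isCompact ?_ ?_ ?_ ?_
    · simp [upperRate_zero hθ]
    · exact fun s t hst ht => (upperRate_mono hθ fun n => measure_mono hst).trans ht
    · intro s t hs ht
      refine (upperRate_mono hθ fun n => measure_union_le s t).trans ?_
      exact (upperRate_add_le hθ hlim).trans (max_le hs ht)
    · intro z hz
      by_contra! hcon
      have hball : ∀ ε > 0, c ≤ upperRate θ fun n => P n (Metric.ball z ε) := fun ε hε =>
        (hcon _ (mem_nhdsWithin_of_mem_nhds (Metric.ball_mem_nhds z hε))).le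
      have hI : localRate P θ z ≤ (-c).toENNReal := iSup_le fun δ =>
        EReal.toENNReal_le_toENNReal (EReal.neg_le_neg_iff.2 (h z c hball δ δ.2))
      have hc' : -c < ((⨅ x ∈ closure A, localRate P θ x : ℝ≥0∞) : EReal) := EReal.neg_lt_comm.1 hc
      refine absurd hc' (not_lt.2 ?_)
      rw [← EReal.coe_toENNReal (x := -c) (by rwa [EReal.le_neg, neg_zero]),
        EReal.coe_ennreal_le_coe_ennreal_iff]
      exact (iInf₂_le z hz).trans hI

end Compact

/-! ### Exponentially good approximations -/

section Approx

variable {Ω : ℕ → Type*} [∀ n, MeasurableSpace (Ω n)] (μ : ∀ n, Measure (Ω n)) (θ : ℕ → ℝ)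
  {S : Type*} [PseudoMetricSpace S]

/-- The random elements `W n` of `S` have regular ball rates: the upper rate of a closed ball is at
most the lower rate of any larger concentric open ball. This is the part of an LDP that survives
continuous maps without any compactness. -/
def BallRegular (W : ∀ n, Ω n → S) : Prop :=
  ∀ (z : S) (r s : ℝ), r < s →
    (upperRate θ fun n => μ n (W n ⁻¹' Metric.closedBall z r)) ≤
      lowerRate θ fun n => μ n (W n ⁻¹' Metric.ball z s)

variable {μ θ}

/-- The bounds of the LDP compare through the infima of the rate function over the preimages of the
two balls, which are nested. -/
lemma SatisfiesLDP.ballRegular_comp {T : Type*} [TopologicalSpace T] [MeasurableSpace T]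
    [OpensMeasurableSpace T] {Y : ∀ n, Ω n → T} (hY : ∀ n, Measurable (Y n))
    (hLDP : SatisfiesLDP (fun n => (μ n).map (Y n)) θ) {f : T → S} (hf : Continuous f) :
    BallRegular μ θ fun n => f ∘ Y n := by
  obtain ⟨hθ, hlim, I, -, hI⟩ := hLDP
  intro z r s hrs
  have hC : IsClosed (f ⁻¹' Metric.closedBall z r) := Metric.isClosed_closedBall.preimage hf
  have hO : IsOpen (f ⁻¹' Metric.ball z s) := Metric.isOpen_ball.preimage hf
  have h1 := (hI _ hC.measurableSet).2
  have h2 := (hI _ hO.measurableSet).1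
  rw [hC.closure_eq] at h1
  rw [hO.interior_eq] at h2
  simp only [Measure.map_apply (hY _) hC.measurableSet] at h1
  simp only [Measure.map_apply (hY _) hO.measurableSet] at h2
  refine (h1.trans ?_).trans h2
  rw [EReal.neg_le_neg_iff, EReal.coe_ennreal_le_coe_ennreal_iff]
  exact biInf_mono fun x hx => Metric.closedBall_subset_ball hrs hx

/-- Random elements `Z n` of a compact space satisfy the LDP as soon as they can be approximated,
up to events of arbitrarily small exponential rate, by random elements with regular ball rates. -/
theorem satisfiesLDP_of_approx [∀ n, IsProbabilityMeasure (μ n)] [CompactSpace S]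
    [MeasurableSpace S] [OpensMeasurableSpace S] (hθ : ∀ n, 0 < θ n) (hlim : Tendsto θ atTop atTop)
    {Z : ∀ n, Ω n → S} (hZ : ∀ n, Measurable (Z n))
    (h : ∀ ε > 0, ∀ M : ℝ, ∃ W : ∀ n, Ω n → S, BallRegular μ θ W ∧
      (upperRate θ fun n => μ n {ω | ε < dist (Z n ω) (W n ω)}) ≤ (M : EReal)) :
    SatisfiesLDP (fun n => (μ n).map (Z n)) θ := by
  have : ∀ n, IsProbabilityMeasure ((μ n).map (Z n)) := fun n =>
    Measure.isProbabilityMeasure_map (hZ n).aemeasurable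
  refine satisfiesLDP_of_ball hθ hlim fun z c hc δ hδ => ?_
  simp only [Measure.map_apply (hZ _) Metric.isOpen_ball.measurableSet] at hc ⊢
  -- Bad events are chosen with rate below `c`; they can then be ignored when passing from `Z` to
  -- `W`, and again when passing back.
  rcases eq_or_ne c ⊥ with rfl | hbot
  · exact bot_le
  obtain ⟨M, -, hM⟩ := EReal.lt_iff_exists_real_btwn.1 (bot_lt_iff_ne_bot.2 hbot)
  obtain ⟨W, hW, hbad⟩ := h (δ / 4) (by positivity) M
  set bad : ℕ → ℝ≥0∞ := fun n => μ n {ω | δ / 4 < dist (Z n ω) (W n ω)}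
  have key1 : c ≤ max (upperRate θ fun n => μ n (W n ⁻¹' Metric.closedBall z (2 * (δ / 4))))
      (upperRate θ bad) := by
    refine (hc (δ / 4) (by positivity)).trans (le_trans (upperRate_mono hθ fun n => ?_)
      (upperRate_add_le hθ hlim))
    refine (measure_mono fun ω hω => ?_).trans (measure_union_le _ _)
    by_cases hd : δ / 4 < dist (Z n ω) (W n ω)
    · exact Or.inr hd
    · left
      have h1 : dist (Z n ω) z < δ / 4 := hω
      have h2 := dist_triangle_left (W n ω) z (Z n ω)
      simp only [mem_preimage, Metric.mem_closedBall]
      linarith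
  have key2 : c ≤ max (lowerRate θ fun n => μ n (Z n ⁻¹' Metric.ball z δ)) (upperRate θ bad) := by
    have h1 : c ≤ upperRate θ fun n => μ n (W n ⁻¹' Metric.closedBall z (2 * (δ / 4))) :=
      (le_max_iff.1 key1).resolve_right (not_le.2 (hbad.trans_lt hM))
    refine (h1.trans (hW z _ (3 * (δ / 4)) (by linarith))).trans
      (le_trans (lowerRate_mono hθ fun n => ?_) (lowerRate_add_le hθ hlim))
    refine (measure_mono fun ω hω => ?_).trans (measure_union_le _ _)
    by_cases hd : δ / 4 < dist (Z n ω) (W n ω)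
    · exact Or.inr hd
    · left
      have h1 : dist (W n ω) z < 3 * (δ / 4) := hω
      have h2 := dist_triangle (Z n ω) (W n ω) z
      simp only [mem_preimage, Metric.mem_ball]
      linarith
  exact (le_max_iff.1 key2).resolve_right (not_le.2 (hbad.trans_lt hM))

end Approx

/-! ### The Prokhorov topology on finite measures over a compact space -/

section Prokhorov

variable {Ω : Type*} [PseudoMetricSpace Ω] [MeasurableSpace Ω] [OpensMeasurableSpace Ω]

open scoped BoundedContinuousFunction

/-- Weak convergence of finite measures on a compact space implies Prokhorov convergence: only
finitely many test functions, one for each union of balls of a finite cover, have to be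
controlled. -/
lemma continuous_ofMeasure_finiteMeasure [CompactSpace Ω] :
    Continuous (LevyProkhorov.ofMeasure (α := FiniteMeasure Ω)) := by
  rw [continuous_iff_continuousAt]
  intro μ
  rw [ContinuousAt, Metric.tendsto_nhds]
  intro ε hε
  -- With balls and test functions at scale `ε / 8`, and integrals controlled up to `ε / 2`, the
  -- Prokhorov distance comes out as at most `5 * (ε / 8) < ε`.
  have hε' : 0 < ε / 8 := by positivity
  obtain ⟨t, -, htf, htc⟩ := (isCompact_univ (X := Ω)).finite_cover_balls hε'
  let U : Set Ω → Set Ω := fun J => ⋃ x ∈ J, Metric.ball x (ε / 8)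
  let g : Set Ω → Ω →ᵇ ℝ≥0 := fun J => thickenedIndicator hε' (U J)
  have hfin : {J | J ⊆ t}.Finite := htf.finite_subsets
  have hclose : ∀ᶠ ν : FiniteMeasure Ω in 𝓝 μ, ∀ J ∈ {J | J ⊆ t},
      dist (ν.testAgainstNN (g J)) (μ.testAgainstNN (g J)) < ε / 2 := by
    refine (eventually_all_finite hfin).2 fun J _ => ?_
    exact Metric.tendsto_nhds.1
      ((FiniteMeasure.continuous_testAgainstNN_eval (g J)).tendsto μ) _ (by positivity)
  filter_upwards [hclose] with ν hν
  have key : ∀ (ν₁ ν₂ : FiniteMeasure Ω), (∀ J ∈ {J | J ⊆ t},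
      dist (ν₁.testAgainstNN (g J)) (ν₂.testAgainstNN (g J)) < ε / 2) → ∀ (r : ℝ) (B : Set Ω),
      5 * (ε / 8) < r → (ν₁ : Measure Ω) B ≤
        (ν₂ : Measure Ω) (Metric.thickening r B) + ENNReal.ofReal r := by
    intro ν₁ ν₂ h r B hr
    -- The balls of the cover that meet `B`: their union contains `B` and is contained in a small
    -- thickening of `B`, and so is the support of the test function attached to them.
    let J : Set Ω := {x ∈ t | (Metric.ball x (ε / 8) ∩ B).Nonempty}
    have hJ : J ∈ {J | J ⊆ t} := sep_subset _ _
    have hB : B ⊆ U J := fun y hy => by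
      obtain ⟨x, hx, hyx⟩ := mem_iUnion₂.1 (htc (mem_univ y))
      exact mem_iUnion₂.2 ⟨x, ⟨hx, y, hyx, hy⟩, hyx⟩
    have h1 : (ν₁ : Measure Ω) B ≤ ν₁.testAgainstNN (g J) := by
      have hU : IsOpen (U J) := isOpen_biUnion fun _ _ => Metric.isOpen_ball
      rw [FiniteMeasure.testAgainstNN_coe_eq]
      exact (measure_mono hB).trans
        (measure_le_lintegral_thickenedIndicator _ hU.measurableSet hε')
    have h2 : (ν₂.testAgainstNN (g J) : ℝ≥0∞) ≤
        (ν₂ : Measure Ω) (Metric.thickening (4 * (ε / 8)) B) := by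
      rw [FiniteMeasure.testAgainstNN_coe_eq,
        ← lintegral_indicator_one Metric.isOpen_thickening.measurableSet]
      refine lintegral_mono fun y => ?_
      by_cases hy : y ∈ Metric.thickening (ε / 8) (U J)
      · obtain ⟨z, hz, hyz⟩ := Metric.mem_thickening_iff.1 hy
        obtain ⟨x, hx, hzx⟩ := mem_iUnion₂.1 hz
        obtain ⟨w, hw, hwB⟩ := hx.2
        have : y ∈ Metric.thickening (4 * (ε / 8)) B := Metric.mem_thickening_iff.2 ⟨w, hwB, by
          have h1 : dist z x < ε / 8 := hzx
          have h2 : dist w x < ε / 8 := hw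
          have h3 := dist_triangle y z w
          have h4 := dist_triangle_right z w x
          linarith⟩
        rw [indicator_of_mem this]
        exact ENNReal.coe_le_one_iff.2 (thickenedIndicator_le_one hε' (U J) y)
      · simp [g, thickenedIndicator_zero hε' _ hy]
    have h3 : ν₁.testAgainstNN (g J) ≤ ν₂.testAgainstNN (g J) + (ε / 2).toNNReal := by
      have := h J hJ
      rw [NNReal.dist_eq] at this
      have := (abs_lt.1 this).2
      rw [← NNReal.coe_le_coe, NNReal.coe_add, Real.coe_toNNReal _ (by positivity)]
      linarith
    calc (ν₁ : Measure Ω) B ≤ ν₁.testAgainstNN (g J) := h1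
      _ ≤ ν₂.testAgainstNN (g J) + ENNReal.ofReal (ε / 2) := by
        rw [ENNReal.ofReal]; exact_mod_cast h3
      _ ≤ (ν₂ : Measure Ω) (Metric.thickening r B) + ENNReal.ofReal r := by
        refine add_le_add (h2.trans (measure_mono (Metric.thickening_mono ?_ B)))
          (ENNReal.ofReal_le_ofReal (by linarith))
        linarith
  refine lt_of_le_of_lt ?_ (show 5 * (ε / 8) < ε by linarith)
  rw [LevyProkhorov.dist_finiteMeasure_def]
  refine ENNReal.toReal_le_of_le_ofReal (by positivity) ?_
  refine levyProkhorovEDist_le_of_forall _ _ _ fun r B h1 h2 _ => ?_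
  have hr : 5 * (ε / 8) < r.toReal := (ENNReal.ofReal_lt_iff_lt_toReal (by positivity) h2.ne).1 h1
  have e : ENNReal.ofReal r.toReal = r := ENNReal.ofReal_toReal h2.ne
  exact ⟨by simpa only [e] using key ν μ hν r.toReal B hr,
    by simpa only [e] using key μ ν (fun J hJ => by rw [dist_comm]; exact hν J hJ) r.toReal B hr⟩

/-- The Prokhorov distance separates finite measures on a compact space. -/
instance [BorelSpace Ω] : T2Space (LevyProkhorov (FiniteMeasure Ω)) := by
  have : T0Space (LevyProkhorov (FiniteMeasure Ω)) := by
    refine ⟨fun μ ν h => ?_⟩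
    have h0 : levyProkhorovEDist μ.toMeasure.toMeasure ν.toMeasure.toMeasure = 0 := by
      have h1 := Metric.inseparable_iff.1 h
      rw [LevyProkhorov.dist_finiteMeasure_def, levyProkhorovDist, ENNReal.toReal_eq_zero_iff] at h1
      exact h1.resolve_right (levyProkhorovEDist_ne_top _ _)
    have hC : ∀ A : Set Ω, IsClosed A →
        (μ.toMeasure : Measure Ω) A = (ν.toMeasure : Measure Ω) A := fun A hA =>
      measure_eq_measure_of_levyProkhorovEDist_eq_zero_of_isClosed h0 hA
        ⟨1, one_pos, measure_ne_top _ _⟩ ⟨1, one_pos, measure_ne_top _ _⟩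
    refine LevyProkhorov.toMeasure_injective (FiniteMeasure.toMeasure_injective ?_)
    refine ext_of_generate_finite _ ?_ isPiSystem_isClosed hC (hC _ isClosed_univ)
    rw [BorelSpace.measurable_eq (α := Ω), borel_eq_generateFrom_isClosed]
  infer_instance

/-- On a compact space, the Prokhorov metric induces the topology of weak convergence on the
measures of mass at most `D`. -/
noncomputable def boundedMeasureHomeomorph {Ω : Type*} [MetricSpace Ω] [MeasurableSpace Ω]
    [BorelSpace Ω] [CompactSpace Ω] (D : ℝ≥0) :
    {μ : FiniteMeasure Ω // μ.mass ≤ D} ≃ₜ BoundedMeasure Ω D :=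
  haveI : CompactSpace {μ : FiniteMeasure Ω // μ.mass ≤ D} :=
    isCompact_iff_compactSpace.1 (isCompact_setOfPred_finiteMeasure_le_of_compactSpace Ω D)
  Continuous.homeoOfEquivCompactToT2
    (f := LevyProkhorov.toMeasureEquiv.symm.subtypeEquiv fun _ => Iff.rfl)
    ((continuous_ofMeasure_finiteMeasure.comp continuous_subtype_val).subtype_mk _)

instance {Ω : Type*} [MetricSpace Ω] [MeasurableSpace Ω]
    [BorelSpace Ω] [CompactSpace Ω] (D : ℝ≥0) : CompactSpace (BoundedMeasure Ω D) :=
  haveI : CompactSpace {μ : FiniteMeasure Ω // μ.mass ≤ D} :=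
    isCompact_iff_compactSpace.1 (isCompact_setOfPred_finiteMeasure_le_of_compactSpace Ω D)
  (boundedMeasureHomeomorph D).compactSpace

lemma BoundedMeasure.continuous_toMeasure {Ω : Type*} [MetricSpace Ω] [MeasurableSpace Ω]
    [BorelSpace Ω] [CompactSpace Ω] (D : ℝ≥0) :
    Continuous fun μ : BoundedMeasure Ω D => μ.1.toMeasure :=
  continuous_subtype_val.comp (boundedMeasureHomeomorph (Ω := Ω) D).symm.continuous

end Prokhorov

instance (D : ℝ≥0) : CompactSpace (MeasurePair D) :=
  inferInstanceAs (CompactSpace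
    (BoundedMeasure unitInterval D × BoundedMeasure (unitInterval × unitInterval) D))

/-! ### Discretization of the unit interval -/

section Cells

variable (k : ℕ) [NeZero k]

/-- The index of the cell of `s` when `[0,1]` is cut into the `k` intervals
`[i/k, (i+1)/k)`, `0 ≤ i < k`, the last of which also contains `1`. -/
noncomputable def cell (s : unitInterval) : Fin k :=
  ⟨min ⌊(k : ℝ) * s⌋₊ (k - 1), by have := NeZero.pos k; omega⟩

/-- The left end point `i/k` of the `i`-th cell. -/
noncomputable def node (i : Fin k) : unitInterval :=
  ⟨(i : ℝ) / k, by positivity, div_le_one_of_le₀ (by exact_mod_cast i.2.le) (by positivity)⟩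

/-- The right end point `(i+1)/k` of the `i`-th cell. -/
noncomputable def nextNode (i : Fin k) : unitInterval :=
  ⟨((i : ℝ) + 1) / k, by positivity, div_le_one_of_le₀ (by exact_mod_cast i.2) (by positivity)⟩

lemma measurable_cell : Measurable (cell k) := by
  have h : Measurable fun s : unitInterval => ⌊(k : ℝ) * s⌋₊ :=
    Nat.measurable_floor.comp (measurable_const.mul measurable_subtype_coe)
  refine measurable_to_countable' fun i => ?_
  have : cell k ⁻¹' {i} = (fun s : unitInterval => min ⌊(k : ℝ) * s⌋₊ (k - 1)) ⁻¹' {(i : ℕ)} := by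
    ext s
    simp [cell, Fin.ext_iff]
  rw [this]
  exact (h.min measurable_const) (measurableSet_singleton _)

lemma preimage_cell_subset (i : Fin k) : cell k ⁻¹' {i} ⊆ Icc (node k i) (nextNode k i) := by
  rintro s rfl
  have hk : (0 : ℝ) < k := by exact_mod_cast NeZero.pos k
  have hs0 : (0 : ℝ) ≤ k * s := mul_nonneg hk.le s.2.1
  constructor
  · change ((min ⌊(k : ℝ) * s⌋₊ (k - 1) : ℕ) : ℝ) / k ≤ s
    rw [div_le_iff₀ hk, mul_comm (s : ℝ)]
    exact (Nat.cast_le.2 (min_le_left _ _)).trans (Nat.floor_le hs0)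
  · change (s : ℝ) ≤ (((min ⌊(k : ℝ) * s⌋₊ (k - 1) : ℕ) : ℝ) + 1) / k
    rw [le_div_iff₀ hk, mul_comm]
    rcases min_cases ⌊(k : ℝ) * s⌋₊ (k - 1) with h | h
    · rw [h.1]; exact (Nat.lt_floor_add_one _).le
    · rw [h.1, Nat.cast_sub (NeZero.pos k)]
      have := mul_le_mul_of_nonneg_left s.2.2 hk.le
      push_cast
      linarith

lemma Ico_subset_preimage_cell (i : Fin k) : Ico (node k i) (nextNode k i) ⊆ cell k ⁻¹' {i} := by
  rintro s ⟨h1, h2⟩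
  have hk : (0 : ℝ) < k := by exact_mod_cast NeZero.pos k
  replace h1 : (i : ℝ) / k ≤ s := h1
  replace h2 : (s : ℝ) < ((i : ℝ) + 1) / k := h2
  rw [div_le_iff₀ hk, mul_comm] at h1
  rw [lt_div_iff₀ hk, mul_comm] at h2
  have hf : ⌊(k : ℝ) * s⌋₊ = i :=
    (Nat.floor_eq_iff ((Nat.cast_nonneg _).trans h1)).2 ⟨h1, h2⟩
  have := i.2
  simp only [mem_preimage, mem_singleton_iff, Fin.ext_iff, cell, hf]
  omega

lemma volume_preimage_cell (i : Fin k) : volume (cell k ⁻¹' {i}) = (k : ℝ≥0∞)⁻¹ := by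
  have hk : (0 : ℝ) < k := by exact_mod_cast NeZero.pos k
  have hlen : ENNReal.ofReal (nextNode k i - node k i) = (k : ℝ≥0∞)⁻¹ := by
    have : ((nextNode k i : ℝ) - node k i) = (k : ℝ)⁻¹ := by
      simp only [nextNode, node]; field_simp; ring
    rw [this, ENNReal.ofReal_inv_of_pos hk, ENNReal.ofReal_natCast]
  apply le_antisymm
  · refine (measure_mono (preimage_cell_subset k i)).trans ?_
    rw [unitInterval.volume_Icc, hlen]
  · refine le_trans ?_ (measure_mono (Ico_subset_preimage_cell k i))
    rw [unitInterval.volume_Ico, hlen]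

lemma dist_node_cell_le (s : unitInterval) : dist s (node k (cell k s)) ≤ 1 / k := by
  obtain ⟨h1, h2⟩ := preimage_cell_subset k (cell k s) rfl
  have h1' : (node k (cell k s) : ℝ) ≤ s := h1
  have h2' : (s : ℝ) ≤ ((cell k s : ℕ) + 1 : ℝ) / k := h2
  rw [Subtype.dist_eq, Real.dist_eq, abs_of_nonneg (by linarith)]
  rw [add_div] at h2'
  change (s : ℝ) - ((cell k s : ℕ) : ℝ) / k ≤ 1 / k
  linarith

lemma measurable_cell_comp (V : Type*) :
    Measurable fun (σ : V → unitInterval) (u : V) => cell k (σ u) :=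
  measurable_pi_lambda _ fun u => (measurable_cell k).comp (measurable_pi_apply u)

/-- The cells of i.i.d. uniform labels form a uniformly random coloring. -/
lemma uniformOn_univ_eq_map_cell (V : Type*) [Fintype V] :
    ProbabilityTheory.uniformOn (univ : Set (V → Fin k)) =
      (volume : Measure (V → unitInterval)).map fun σ u => cell k (σ u) := by
  classical
  refine Measure.ext_of_singleton fun τ => ?_
  have hpre : (fun (σ : V → unitInterval) (u : V) => cell k (σ u)) ⁻¹' {τ} =
      univ.pi fun u => cell k ⁻¹' {τ u} := by
    ext σ
    simp [funext_iff]
  rw [Measure.map_apply (measurable_cell_comp k V) (measurableSet_singleton _), hpre, volume_pi_pi]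
  simp only [volume_preimage_cell, Finset.prod_const]
  rw [ProbabilityTheory.uniformOn_univ, Measure.count_singleton, Fintype.card_fun, Fintype.card_fin,
    Finset.card_univ, one_div, Nat.cast_pow, ENNReal.inv_pow]

end Cells

section Graph

variable {V : Type*} [Fintype V] (G : SimpleGraph V) [DecidableRel G.Adj] {D : ℝ≥0}

lemma quotientLaw_eq_map_cell (hD : 1 ≤ D) (hdeg : ∀ v, (G.degree v : ℝ≥0) ≤ D)
    (k : ℕ) [NeZero k] :
    quotientLaw G hD hdeg k = (volume : Measure (V → unitInterval)).map
      fun σ => quotient G hD hdeg fun u => cell k (σ u) := by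
  rw [quotientLaw, uniformOn_univ_eq_map_cell,
    Measure.map_map (measurable_of_finite _) (measurable_cell_comp k V)]
  rfl

end Graph

/-! ### From quotients to pairs of measures -/

section Weighted

variable {Ω : Type*} [MeasurableSpace Ω] {ι : Type*} [Fintype ι]

/-- The measure `∑ i, w i • δ_{c i}`, scaled down to total mass `D` if its mass is larger. The
scaling makes the map total on the space of all weights. -/
noncomputable def weightedMeasure (D : ℝ≥0) (c : ι → Ω) (w : ι → ℝ≥0) : BoundedMeasure Ω D :=
  ⟨.ofMeasure ((D / max D (∑ i, w i)) • ∑ i, w i • (diracProba (c i)).toFiniteMeasure), by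
    have hmass : ∀ (a : ℝ≥0) (ν : FiniteMeasure Ω), (a • ν).mass = a * ν.mass := fun a ν => by
      simp [FiniteMeasure.mass]
    have hsum : (∑ i, w i • (diracProba (c i)).toFiniteMeasure).mass = ∑ i, w i := by
      rw [← ENNReal.coe_inj, FiniteMeasure.ennreal_mass, FiniteMeasure.toMeasure_sum]
      simp [FiniteMeasure.toMeasure_smul, Measure.finsetSum_apply]
    change ((D / max D (∑ i, w i)) • ∑ i, w i • (diracProba (c i)).toFiniteMeasure).mass ≤ D
    rw [hmass, hsum, div_mul_eq_mul_div]
    refine div_le_of_le_mul₀ zero_le zero_le ?_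
    exact mul_le_mul_right (le_max_right _ _) _⟩

lemma weightedMeasure_toMeasure {D : ℝ≥0} (hD : 0 < D) (c : ι → Ω) {w : ι → ℝ≥0}
    (hw : ∑ i, w i ≤ D) :
    (weightedMeasure D c w).1.toMeasure =
      ∑ i, w i • (diracProba (c i)).toFiniteMeasure := by
  simp [weightedMeasure, max_eq_left hw, div_self hD.ne']

lemma continuous_weightedMeasure [MetricSpace Ω] [BorelSpace Ω] [CompactSpace Ω] {D : ℝ≥0}
    (hD : 0 < D) (c : ι → Ω) : Continuous (weightedMeasure D c) := by
  refine Continuous.subtype_mk (continuous_ofMeasure_finiteMeasure.comp ?_) _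
  have h : ∀ w : ι → ℝ≥0, max D (∑ i, w i) ≠ 0 := fun w => (hD.trans_le (le_max_left _ _)).ne'
  fun_prop (disch := exact h _)

/-- Grouping the atoms of a measure with equal weights according to their positions. -/
lemma sum_card_smul_dirac {κ : Type*} [Fintype κ] [DecidableEq ι] (a : ℝ≥0) (e : κ → ι) (c : ι → Ω) :
    ∑ i, ((Fintype.card {j // e j = i} : ℝ≥0) * a) • (diracProba (c i)).toFiniteMeasure =
      atomicMeasure a fun j => c (e j) := by
  rw [atomicMeasure, ← Finset.sum_fiberwise Finset.univ e]
  refine Finset.sum_congr rfl fun i _ => ?_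
  rw [Finset.sum_congr rfl (g := fun _ => a • (diracProba (c i)).toFiniteMeasure), Finset.sum_const,
    Fintype.card_subtype, mul_smul, Nat.cast_smul_eq_nsmul]
  intro j hj
  rw [(Finset.mem_filter.1 hj).2]

end Weighted

section ToMeasure

variable {V : Type*} [Fintype V] (G : SimpleGraph V) [DecidableRel G.Adj] {D : ℝ≥0}

lemma dist_measurePair_le (hD : 1 ≤ D) (hdeg : ∀ v, (G.degree v : ℝ≥0) ≤ D)
    (σ τ : V → unitInterval) :
    dist (measurePair G hD hdeg σ) (measurePair G hD hdeg τ) ≤ dist σ τ := by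
  refine max_le (dist_atomicMeasure_le _ _ _) ((dist_atomicMeasure_le _ _ _).trans ?_)
  refine (dist_pi_le_iff dist_nonneg).2 fun e => ?_
  exact max_le (dist_le_pi_dist σ τ e.fst) (dist_le_pi_dist σ τ e.snd)

/-- The pair of atomic measures that puts the masses `x i` on the points `i/k` and `X i j` on the
points `(i/k, j/k)`, scaled down where the total mass exceeds `D`. -/
noncomputable def nodeMeasurePair (D : ℝ≥0) (k : ℕ) [NeZero k] (q : QuotientSpace D k) :
    MeasurePair D :=
  (weightedMeasure D (node k) fun i => ⟨q.1 i, (q.1 i).2.1⟩,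
   weightedMeasure D (fun p : Fin k × Fin k => (node k p.1, node k p.2))
     fun p => ⟨q.2 p.1 p.2, (q.2 p.1 p.2).2.1⟩)

lemma continuous_nodeMeasurePair (hD : 0 < D) (k : ℕ) [NeZero k] :
    Continuous (nodeMeasurePair D k) := by
  refine Continuous.prodMk ((continuous_weightedMeasure hD _).comp ?_)
    ((continuous_weightedMeasure hD _).comp ?_)
  · refine continuous_pi fun i => Continuous.subtype_mk ?_ _
    fun_prop
  · refine continuous_pi fun i => Continuous.subtype_mk ?_ _
    fun_prop

/-- On quotients of colorings the masses do not exceed `D`, so that no scaling takes place. -/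
lemma nodeMeasurePair_quotient (hD : 1 ≤ D) (hdeg : ∀ v, (G.degree v : ℝ≥0) ≤ D)
    (k : ℕ) [NeZero k] (τ : V → Fin k) :
    nodeMeasurePair D k (quotient G hD hdeg τ) = measurePair G hD hdeg fun u => node k (τ u) := by
  have hD0 : 0 < D := one_pos.trans_le hD
  have hsum : ∀ {ι κ : Type _} [Fintype ι] [Fintype κ] [DecidableEq ι] (e : κ → ι) (a : ℝ≥0),
      ∑ i, (Fintype.card {j // e j = i} : ℝ≥0) * a = Fintype.card κ * a := by
    intro ι κ _ _ _ e a
    rw [← Finset.sum_mul]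
    congr 1
    rw [← Nat.cast_sum, ← Fintype.card_sigma, Fintype.card_congr (Equiv.sigmaFiberEquiv e)]
  have h1 : (fun i => ⟨(quotient G hD hdeg τ).1 i, ((quotient G hD hdeg τ).1 i).2.1⟩ : Fin k → ℝ≥0)
      = fun i => (Fintype.card {u // τ u = i} : ℝ≥0) * (Fintype.card V : ℝ≥0)⁻¹ := by
    ext i
    simp [quotient, div_eq_mul_inv]
  have h2 : (fun p => ⟨(quotient G hD hdeg τ).2 p.1 p.2,
        ((quotient G hD hdeg τ).2 p.1 p.2).2.1⟩ : Fin k × Fin k → ℝ≥0)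
      = fun p => (Fintype.card {e : G.Dart // (τ e.fst, τ e.snd) = p} : ℝ≥0) *
        (Fintype.card V : ℝ≥0)⁻¹ := by
    refine funext fun p => NNReal.eq ?_
    simp only [quotient, div_eq_mul_inv, NNReal.coe_mul, NNReal.coe_natCast, NNReal.coe_inv,
      Prod.ext_iff]
    rfl
  refine Prod.ext (Subtype.ext (LevyProkhorov.toMeasure_injective ?_))
    (Subtype.ext (LevyProkhorov.toMeasure_injective ?_))
  · refine (weightedMeasure_toMeasure hD0 _ ?_).trans ?_
    · rw [h1, hsum]
      exact mul_inv_le_one.trans hD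
    · simp only [congrFun h1]
      exact sum_card_smul_dirac _ τ _
  · refine (weightedMeasure_toMeasure hD0 _ ?_).trans ?_
    · rw [h2, hsum fun e : G.Dart => (τ e.fst, τ e.snd)]
      exact card_dart_le G hdeg
    · simp only [congrFun h2]
      exact sum_card_smul_dirac _ (fun e : G.Dart => (τ e.fst, τ e.snd)) _

lemma dist_nodeMeasurePair_quotient_le (hD : 1 ≤ D) (hdeg : ∀ v, (G.degree v : ℝ≥0) ≤ D)
    (k : ℕ) [NeZero k] (σ : V → unitInterval) :
    dist (measurePair G hD hdeg σ)
      (nodeMeasurePair D k (quotient G hD hdeg fun u => cell k (σ u))) ≤ 1 / k := by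
  rw [nodeMeasurePair_quotient]
  refine (dist_measurePair_le G hD hdeg _ _).trans ((dist_pi_le_iff (by positivity)).2 fun u => ?_)
  exact dist_node_cell_le k (σ u)

end ToMeasure

/-- The coloring by cells determines the pair of measures up to Prokhorov distance `1 / k`, so here
the approximation is deterministic. -/
theorem LDConvergent.of_kLDConvergent {V : ℕ → Type*} [∀ n, Fintype (V n)]
    {G : ∀ n, SimpleGraph (V n)} [∀ n, DecidableRel (G n).Adj] {D : ℝ≥0} {hD : 1 ≤ D}
    {hdeg : ∀ n v, ((G n).degree v : ℝ≥0) ≤ D}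
    (h : ∀ k : ℕ, 1 ≤ k → KLDConvergent G hD hdeg k) : LDConvergent G hD hdeg := by
  obtain ⟨hθ, hlim, -⟩ := h 1 le_rfl
  refine satisfiesLDP_of_approx hθ hlim
    (fun n => (continuous_measurePair (G n) hD (hdeg n)).measurable) fun ε hε M => ?_
  obtain ⟨m, hm⟩ := exists_nat_one_div_lt hε
  let Q : ∀ n, (V n → unitInterval) → QuotientSpace D (m + 1) := fun n σ =>
    quotient (G n) hD (hdeg n) fun u => cell (m + 1) (σ u)
  have hQ : ∀ n, Measurable (Q n) := fun n =>
    (measurable_of_finite (quotient (G n) hD (hdeg n))).comp (measurable_cell_comp (m + 1) (V n))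
  have hLDP : SatisfiesLDP (fun n => (volume : Measure (V n → unitInterval)).map (Q n))
      fun n => (Fintype.card (V n) : ℝ) := by
    have := h (m + 1) (by omega)
    rw [KLDConvergent, funext fun n => quotientLaw_eq_map_cell (G n) hD (hdeg n) (m + 1)] at this
    exact this
  refine ⟨_, hLDP.ballRegular_comp hQ (continuous_nodeMeasurePair (one_pos.trans_le hD) (m + 1)), ?_⟩
  have hempty : ∀ n, {σ : V n → unitInterval | ε < dist (measurePair (G n) hD (hdeg n) σ)
      ((nodeMeasurePair D (m + 1) ∘ Q n) σ)} = ∅ := fun n => by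
    refine eq_empty_of_forall_notMem fun σ hσ => ?_
    have h1 : dist (measurePair (G n) hD (hdeg n) σ) (nodeMeasurePair D (m + 1) (Q n σ)) ≤
        1 / ((m + 1 : ℕ) : ℝ) := dist_nodeMeasurePair_quotient_le (G n) hD (hdeg n) (m + 1) σ
    push_cast at h1
    exact absurd (lt_of_lt_of_le hσ h1) (not_lt.2 hm.le)
  simp only [hempty, measure_empty, upperRate_zero hθ]
  exact bot_le

open scoped BoundedContinuousFunction

/-! ### From pairs of measures to quotients -/

section Smoothing

/-- An indicator function on the unit interval is continuous up to changing it on a set of small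
measure. -/
lemma exists_continuous_eq_indicator {A : Set unitInterval} (hA : MeasurableSet A) {η : ℝ≥0∞}
    (hη : 0 < η) :
    ∃ (φ : unitInterval →ᵇ ℝ≥0) (N : Set unitInterval), MeasurableSet N ∧ volume N ≤ η ∧
      (∀ s, φ s ≤ 1) ∧ ∀ s ∉ N, φ s = A.indicator 1 s := by
  obtain ⟨F, hFA, hF, hFη⟩ := hA.exists_isClosed_sdiff_lt (measure_ne_top volume A)
    (ENNReal.half_pos hη.ne').ne'
  have hlim := tendsto_measure_thickening_of_isClosed (μ := (volume : Measure unitInterval))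
    (s := F) ⟨1, one_pos, measure_ne_top _ _⟩ hF
  have hlt : volume F < volume F + η / 2 :=
    ENNReal.lt_add_right (measure_ne_top _ _) (ENNReal.half_pos hη.ne').ne'
  obtain ⟨δ, hδF, hδ⟩ :=
    ((hlim.eventually (gt_mem_nhds hlt)).and self_mem_nhdsWithin).exists
  have hT : MeasurableSet (Metric.thickening δ F) := Metric.isOpen_thickening.measurableSet
  have hFT : F ⊆ Metric.thickening δ F := Metric.self_subset_thickening hδ F
  refine ⟨thickenedIndicator hδ F, A \ F ∪ Metric.thickening δ F \ F,
    (hA.diff hF.measurableSet).union (hT.diff hF.measurableSet), ?_,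
    thickenedIndicator_le_one hδ F, fun s hs => ?_⟩
  · refine (measure_union_le _ _).trans ?_
    rw [← ENNReal.add_halves η]
    refine add_le_add hFη.le ?_
    rw [measure_sdiff hFT hF.measurableSet.nullMeasurableSet (measure_ne_top _ _)]
    exact tsub_le_iff_left.2 hδF.le
  · by_cases hsF : s ∈ F
    · rw [thickenedIndicator_one hδ F hsF, indicator_of_mem (hFA hsF), Pi.one_apply]
    · have hsA : s ∉ A := fun h => hs (Or.inl ⟨h, hsF⟩)
      have hsT : s ∉ Metric.thickening δ F := fun h => hs (Or.inr ⟨h, hsF⟩)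
      rw [thickenedIndicator_zero hδ F hsT, indicator_of_notMem hsA]

/-- The indicator functions of the cells are continuous outside of a common set of small
measure. -/
lemma exists_continuous_eq_indicator_cell (k : ℕ) [NeZero k] {η : ℝ≥0∞} (hη : 0 < η) :
    ∃ (φ : Fin k → unitInterval →ᵇ ℝ≥0) (N : Set unitInterval), MeasurableSet N ∧ volume N ≤ η ∧
      (∀ i s, φ i s ≤ 1) ∧ ∀ i, ∀ s ∉ N, φ i s = if cell k s = i then 1 else 0 := by
  have hk : (k : ℝ≥0∞) ≠ 0 := by exact_mod_cast NeZero.ne k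
  have hηk : 0 < η / k := ENNReal.div_pos hη.ne' (ENNReal.natCast_ne_top k)
  choose φ N hN hvol hle hφ using fun i =>
    exists_continuous_eq_indicator (measurable_cell k (measurableSet_singleton i)) hηk
  refine ⟨φ, ⋃ i, N i, MeasurableSet.iUnion hN, ?_, hle, fun i s hs => ?_⟩
  · calc volume (⋃ i, N i) ≤ ∑ i, volume (N i) := measure_iUnion_fintype_le _ _
      _ ≤ ∑ _i : Fin k, η / k := Finset.sum_le_sum fun i _ => hvol i
      _ = η := by
        rw [Finset.sum_const, Finset.card_univ, Fintype.card_fin, nsmul_eq_mul,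
          ENNReal.mul_div_cancel hk (ENNReal.natCast_ne_top k)]
  · rw [hφ i s fun h => hs (mem_iUnion.2 ⟨i, h⟩)]
    simp [indicator]

lemma testAgainstNN_atomicMeasure {ι Ω : Type*} [Fintype ι] [TopologicalSpace Ω]
    [MeasurableSpace Ω] [OpensMeasurableSpace Ω] (c : ℝ≥0) (f : ι → Ω) (g : Ω →ᵇ ℝ≥0) :
    (atomicMeasure c f).testAgainstNN g = c * ∑ i, g (f i) := by
  rw [← ENNReal.coe_inj, FiniteMeasure.testAgainstNN_coe_eq, atomicMeasure_toMeasure,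
    lintegral_finsetSum_measure, Finset.mul_sum, ENNReal.ofNNReal_finsetSum]
  refine Finset.sum_congr rfl fun i _ => ?_
  rw [lintegral_smul_measure,
    lintegral_dirac' _ (BoundedContinuousFunction.measurable_coe_ennreal_comp g), ENNReal.coe_mul]
  rfl

lemma testAgainstNN_le {Ω : Type*} [TopologicalSpace Ω] [MeasurableSpace Ω]
    [OpensMeasurableSpace Ω] {μ : FiniteMeasure Ω} {D : ℝ≥0} (hμ : μ.mass ≤ D) {g : Ω →ᵇ ℝ≥0}
    (hg : ∀ x, g x ≤ 1) : μ.testAgainstNN g ≤ D := by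
  refine le_trans ?_ hμ
  rw [← FiniteMeasure.testAgainstNN_one]
  exact FiniteMeasure.testAgainstNN_mono μ hg

/-- The function `(s, t) ↦ φ s * ψ t` on the unit square. -/
noncomputable def tensor (φ ψ : unitInterval →ᵇ ℝ≥0) : unitInterval × unitInterval →ᵇ ℝ≥0 :=
  BoundedContinuousFunction.mkOfCompact ⟨fun p => φ p.1 * ψ p.2, by fun_prop⟩

variable {D : ℝ≥0} {k : ℕ}

/-- The quotient `(∫ φ i dρ, ∫ φ i ⊗ φ j dμ)` of a pair `(ρ, μ)` of measures by a family of
continuous functions `φ i` in place of the indicator functions of the cells. -/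
noncomputable def smoothQuotient (D : ℝ≥0) (φ : Fin k → unitInterval →ᵇ ℝ≥0)
    (hφ : ∀ i s, φ i s ≤ 1) (p : MeasurePair D) : QuotientSpace D k :=
  (fun i => ⟨p.1.1.toMeasure.testAgainstNN (φ i), NNReal.coe_nonneg _, by
      exact_mod_cast testAgainstNN_le p.1.2 (hφ i)⟩,
   fun i j => ⟨p.2.1.toMeasure.testAgainstNN (tensor (φ i) (φ j)), NNReal.coe_nonneg _, by
      exact_mod_cast testAgainstNN_le p.2.2 fun s => mul_le_one' (hφ i s.1) (hφ j s.2)⟩)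

lemma continuous_smoothQuotient (φ : Fin k → unitInterval →ᵇ ℝ≥0) (hφ : ∀ i s, φ i s ≤ 1) :
    Continuous (smoothQuotient D φ hφ) := by
  have h1 : Continuous fun p : MeasurePair D => p.1.1.toMeasure :=
    (BoundedMeasure.continuous_toMeasure D).comp continuous_fst
  have h2 : Continuous fun p : MeasurePair D => p.2.1.toMeasure :=
    (BoundedMeasure.continuous_toMeasure D).comp continuous_snd
  refine Continuous.prodMk (continuous_pi fun i => Continuous.subtype_mk ?_ _)
    (continuous_pi fun i => continuous_pi fun j => Continuous.subtype_mk ?_ _)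
  · exact NNReal.continuous_coe.comp ((FiniteMeasure.continuous_testAgainstNN_eval _).comp h1)
  · exact NNReal.continuous_coe.comp ((FiniteMeasure.continuous_testAgainstNN_eval _).comp h2)

end Smoothing

section Comparison

/-- Two averages of `[0,1]`-valued functions differ at most by the proportion of the indices where
the functions differ. -/
lemma abs_average_sub_le {ι : Type*} [Fintype ι] {F₁ F₂ : ι → ℝ} (h₁ : ∀ i, F₁ i ∈ Icc (0 : ℝ) 1)
    (h₂ : ∀ i, F₂ i ∈ Icc (0 : ℝ) 1) (B : Finset ι) (hB : ∀ i ∉ B, F₁ i = F₂ i) {c : ℝ}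
    (hc : 0 ≤ c) : |c * ∑ i, F₁ i - c * ∑ i, F₂ i| ≤ c * B.card := by
  rw [← mul_sub, abs_mul, abs_of_nonneg hc, ← Finset.sum_sub_distrib]
  refine mul_le_mul_of_nonneg_left ?_ hc
  rw [← Finset.sum_subset (Finset.subset_univ B) fun i _ hi => sub_eq_zero.2 (hB i hi)]
  refine (Finset.abs_sum_le_sum_abs _ _).trans ?_
  refine (Finset.sum_le_card_nsmul B _ 1 fun i _ => ?_).trans (by simp)
  rw [abs_le]
  constructor <;> linarith [(h₁ i).1, (h₁ i).2, (h₂ i).1, (h₂ i).2]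

variable {V : Type*} [Fintype V] (G : SimpleGraph V) [DecidableRel G.Adj] {D : ℝ≥0}

/-- At most `2 D |B|` oriented edges touch a set `B` of nodes. -/
lemma card_dart_touching_le (hdeg : ∀ v, (G.degree v : ℝ≥0) ≤ D) [DecidableEq V] (B : Finset V) :
    ((Finset.univ.filter fun e : G.Dart => e.fst ∈ B ∨ e.snd ∈ B).card : ℝ) ≤ 2 * D * B.card := by
  have h1 : ((Finset.univ.filter fun e : G.Dart => e.fst ∈ B).card : ℝ) ≤ D * B.card := by
    rw [Finset.card_eq_sum_card_fiberwise (f := fun e : G.Dart => e.fst) (t := B)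
      fun e he => by simpa using he]
    push_cast
    rw [mul_comm, ← nsmul_eq_mul]
    refine Finset.sum_le_card_nsmul _ _ _ fun v _ =>
      (Nat.cast_le.2 (?_ : _ ≤ G.degree v)).trans (by exact_mod_cast hdeg v)
    rw [← G.dart_fst_fiber_card_eq_degree v]
    exact Finset.card_le_card fun e he => by simpa using (Finset.mem_filter.1 he).2
  have h2 : (Finset.univ.filter fun e : G.Dart => e.snd ∈ B).card =
      (Finset.univ.filter fun e : G.Dart => e.fst ∈ B).card :=
    Finset.card_bij' (fun e _ => e.symm) (fun e _ => e.symm) (by simp) (by simp) (by simp) (by simp)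
  rw [Finset.filter_or]
  refine (Nat.cast_le.2 (Finset.card_union_le _ _)).trans ?_
  push_cast
  rw [h2]
  linarith

/-- Replacing the indicator functions of the cells by the functions `φ i`, which agree with them
outside of `N`, changes the quotient by at most `2 D / |V|` for each label in `N`. -/
lemma dist_smoothQuotient_le (hD : 1 ≤ D) (hdeg : ∀ v, (G.degree v : ℝ≥0) ≤ D) {k : ℕ} [NeZero k]
    {φ : Fin k → unitInterval →ᵇ ℝ≥0} (hφ : ∀ i s, φ i s ≤ 1) {N : Set unitInterval}
    (hN : ∀ i, ∀ s ∉ N, φ i s = if cell k s = i then 1 else 0) (σ : V → unitInterval)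
    {B : Finset V} (hB : ∀ u, σ u ∈ N → u ∈ B) :
    dist (quotient G hD hdeg fun u => cell k (σ u))
      (smoothQuotient D φ hφ (measurePair G hD hdeg σ)) ≤
        (Fintype.card V : ℝ)⁻¹ * (2 * D * B.card) := by
  classical
  have hc : (0 : ℝ) ≤ (Fintype.card V : ℝ)⁻¹ := by positivity
  have hD' : (1 : ℝ) ≤ D := by exact_mod_cast hD
  have hr : 0 ≤ (Fintype.card V : ℝ)⁻¹ * (2 * D * B.card) := by positivity
  have hN' : ∀ i u, u ∉ B → (φ i (σ u) : ℝ) = if cell k (σ u) = i then 1 else 0 := fun i u hu => by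
    rw [hN i (σ u) fun h => hu (hB u h)]
    split_ifs <;> simp
  have hφ' : ∀ i s, (φ i s : ℝ) ∈ Icc (0 : ℝ) 1 := fun i s =>
    ⟨NNReal.coe_nonneg _, by exact_mod_cast hφ i s⟩
  have hind : ∀ p : Prop, [Decidable p] → (if p then 1 else 0 : ℝ) ∈ Icc (0 : ℝ) 1 := by
    intro p _; split_ifs <;> simp
  refine max_le ((dist_pi_le_iff hr).2 fun i => ?_)
    ((dist_pi_le_iff hr).2 fun i => (dist_pi_le_iff hr).2 fun j => ?_)
  · have h1 : (((quotient G hD hdeg fun u => cell k (σ u)).1 i : ℝ)) =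
        (Fintype.card V : ℝ)⁻¹ * ∑ u, if cell k (σ u) = i then 1 else 0 := by
      simp [quotient, Fintype.card_subtype, div_eq_inv_mul]
    have h2 : ((smoothQuotient D φ hφ (measurePair G hD hdeg σ)).1 i : ℝ) =
        (Fintype.card V : ℝ)⁻¹ * ∑ u, (φ i (σ u) : ℝ) := by
      simp only [smoothQuotient, measurePair, testAgainstNN_atomicMeasure]
      push_cast
      rfl
    rw [Subtype.dist_eq, Real.dist_eq, h1, h2]
    refine (abs_average_sub_le (fun u => hind _) (fun u => hφ' i _) B
      (fun u hu => (hN' i u hu).symm) hc).trans (mul_le_mul_of_nonneg_left ?_ hc)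
    have : (0 : ℝ) ≤ B.card := by positivity
    nlinarith
  · have h1 : (((quotient G hD hdeg fun u => cell k (σ u)).2 i j : ℝ)) =
        (Fintype.card V : ℝ)⁻¹ *
          ∑ e : G.Dart, if cell k (σ e.fst) = i ∧ cell k (σ e.snd) = j then 1 else 0 := by
      simp [quotient, Fintype.card_subtype, div_eq_inv_mul]
    have h2 : ((smoothQuotient D φ hφ (measurePair G hD hdeg σ)).2 i j : ℝ) =
        (Fintype.card V : ℝ)⁻¹ * ∑ e : G.Dart, (φ i (σ e.fst) * φ j (σ e.snd) : ℝ) := by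
      simp only [smoothQuotient, measurePair, testAgainstNN_atomicMeasure]
      push_cast
      rfl
    rw [Subtype.dist_eq, Real.dist_eq, h1, h2]
    refine (abs_average_sub_le (fun e => hind _) (fun e => ?_)
      (Finset.univ.filter fun e : G.Dart => e.fst ∈ B ∨ e.snd ∈ B) (fun e he => ?_) hc).trans
      (mul_le_mul_of_nonneg_left (card_dart_touching_le G hdeg B) hc)
    · exact ⟨mul_nonneg (hφ' _ _).1 (hφ' _ _).1,
        mul_le_one₀ (hφ' _ _).2 (hφ' _ _).1 (hφ' _ _).2⟩
    · simp only [Finset.mem_filter, Finset.mem_univ, true_and, not_or] at he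
      rw [hN' i _ he.1, hN' j _ he.2]
      split_ifs <;> simp_all

end Comparison

/-! ### Labels in a set of small measure -/

section Tail

/-- The probability that more than `r` of the i.i.d. uniform labels fall into a set of measure
at most `η`: union bound over the sets of nodes. -/
lemma volume_card_lt_le (V : Type*) [Fintype V] {N : Set unitInterval} [DecidablePred (· ∈ N)]
    {η : ℝ≥0∞} (hη : η ≤ 1) (hN : volume N ≤ η) (r : ℝ) :
    volume {σ : V → unitInterval | r < (Finset.univ.filter fun u => σ u ∈ N).card} ≤
      2 ^ Fintype.card V * η ^ r := by
  classical
  have hsub : {σ : V → unitInterval | r < (Finset.univ.filter fun u => σ u ∈ N).card} ⊆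
      ⋃ W ∈ Finset.univ.filter fun W : Finset V => r < W.card,
        univ.pi fun u => if u ∈ W then N else univ := by
    intro σ hσ
    refine mem_iUnion₂.2 ⟨Finset.univ.filter fun u => σ u ∈ N, by simpa using hσ, fun u _ => ?_⟩
    by_cases h : σ u ∈ N <;> simp [h]
  refine (measure_mono hsub).trans ((measure_biUnion_finset_le _ _).trans ?_)
  have hW : ∀ W ∈ Finset.univ.filter fun W : Finset V => r < W.card,
      volume (univ.pi fun u => if u ∈ W then N else univ) ≤ η ^ r := by
    intro W hW
    have hr : r < W.card := by simpa using hW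
    rw [volume_pi_pi]
    calc ∏ u, volume (if u ∈ W then N else univ) ≤ ∏ u, if u ∈ W then η else 1 :=
          Finset.prod_le_prod' fun u _ => by split_ifs <;> simp [hN]
      _ = η ^ (W.card : ℝ) := by rw [Finset.prod_ite_mem]; simp
      _ ≤ η ^ r := ENNReal.rpow_le_rpow_of_exponent_ge hη hr.le
  refine (Finset.sum_le_card_nsmul _ _ _ hW).trans ?_
  rw [nsmul_eq_mul]
  gcongr
  have : (Finset.univ.filter fun W : Finset V => r < W.card).card ≤ 2 ^ Fintype.card V := by
    refine (Finset.card_filter_le _ _).trans ?_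
    simp
  exact_mod_cast this

lemma upperRate_le_of_le_exp {θ : ℕ → ℝ} (hθ : ∀ n, 0 < θ n) {u : ℕ → ℝ≥0∞} {M : ℝ}
    (h : ∀ n, u n ≤ ENNReal.ofReal (Real.exp (M * θ n))) : upperRate θ u ≤ M := by
  refine (upperRate_mono hθ h).trans ?_
  have : ∀ n, ENNReal.log (ENNReal.ofReal (Real.exp (M * θ n))) / ((θ n : ℝ) : EReal) = (M : EReal) :=
    fun n => by
      rw [ENNReal.log_ofReal_of_pos (Real.exp_pos _), Real.log_exp, ← EReal.coe_div,
        mul_div_cancel_right₀ _ (hθ n).ne']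
  rw [upperRate, funext this, limsup_const]

end Tail

/-- The quotient is not a continuous function of the pair of measures, but it differs from a
continuous one by more than `ε` only if a positive proportion of the labels falls into a set of
small measure, an event of small exponential rate. -/
theorem LDConvergent.kLDConvergent {V : ℕ → Type*} [∀ n, Fintype (V n)]
    {G : ∀ n, SimpleGraph (V n)} [∀ n, DecidableRel (G n).Adj] {D : ℝ≥0} {hD : 1 ≤ D}
    {hdeg : ∀ n v, ((G n).degree v : ℝ≥0) ≤ D}
    (h : LDConvergent G hD hdeg) (k : ℕ) (hk : 1 ≤ k) : KLDConvergent G hD hdeg k := by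
  classical
  have : NeZero k := ⟨by omega⟩
  obtain ⟨hθ, hlim, -⟩ := id h
  rw [KLDConvergent, funext fun n => quotientLaw_eq_map_cell (G n) hD (hdeg n) k]
  refine satisfiesLDP_of_approx hθ hlim (fun n => (measurable_of_finite
    (quotient (G n) hD (hdeg n))).comp (measurable_cell_comp k (V n))) fun ε hε M => ?_
  have hD0 : (0 : ℝ) < D := one_pos.trans_le (by exact_mod_cast hD)
  set t : ℝ := ε / (2 * D) with ht
  have ht0 : 0 < t := by positivity
  -- The constant `K` makes the union bound `2 * exp (-K * t)` at most `exp M`.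
  set K : ℝ := max 0 ((Real.log 2 - M) / t)
  have hKM : Real.log 2 - K * t ≤ M := by
    have : (Real.log 2 - M) / t ≤ K := le_max_right _ _
    rw [div_le_iff₀ ht0] at this
    linarith
  obtain ⟨φ, N, -, hvol, hφ, hφN⟩ := exists_continuous_eq_indicator_cell k
    (η := ENNReal.ofReal (Real.exp (-K))) (by simp [Real.exp_pos])
  refine ⟨_, SatisfiesLDP.ballRegular_comp
    (fun n => (continuous_measurePair (G n) hD (hdeg n)).measurable) h
    (continuous_smoothQuotient φ hφ), upperRate_le_of_le_exp hθ fun n => ?_⟩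
  have hsub : {σ : V n → unitInterval | ε < dist (quotient (G n) hD (hdeg n) fun u => cell k (σ u))
      ((smoothQuotient D φ hφ ∘ measurePair (G n) hD (hdeg n)) σ)} ⊆
      {σ | t * Fintype.card (V n) < (Finset.univ.filter fun u => σ u ∈ N).card} := by
    intro σ hσ
    have h1 := lt_of_lt_of_le (mem_ofPred_eq ▸ hσ) (dist_smoothQuotient_le (G n) hD (hdeg n) hφ hφN σ
      (B := Finset.univ.filter fun u => σ u ∈ N) (by simp))
    rw [inv_mul_eq_div, lt_div_iff₀ (hθ n)] at h1
    change t * _ < _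
    rw [ht, div_mul_eq_mul_div, div_lt_iff₀ (by positivity)]
    linarith
  refine (measure_mono hsub).trans ((volume_card_lt_le (V n)
    (ENNReal.ofReal_le_one.2 (Real.exp_le_one_iff.2 (neg_nonpos.2 (le_max_left _ _)))) hvol _).trans ?_)
  rw [ENNReal.ofReal_rpow_of_pos (Real.exp_pos _), ← Real.exp_mul]
  have h2 : (2 : ℝ≥0∞) ^ Fintype.card (V n) =
      ENNReal.ofReal (Real.exp (Real.log 2 * Fintype.card (V n))) := by
    rw [Real.exp_mul, Real.exp_log two_pos, Real.rpow_natCast, ENNReal.ofReal_pow two_pos.le]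
    simp
  rw [h2, ← ENNReal.ofReal_mul (Real.exp_pos _).le, ← Real.exp_add]
  refine ENNReal.ofReal_le_ofReal (Real.exp_le_exp.2 ?_)
  have := mul_le_mul_of_nonneg_right hKM (hθ n).le
  linarith

end LDGraph

theorem mainTheorem1 {V : ℕ → Type*} [∀ n, Fintype (V n)] (G : ∀ n, SimpleGraph (V n))
    [∀ n, DecidableRel (G n).Adj] (D : ℝ≥0) (hD : 1 ≤ D)
    (hdeg : ∀ n v, ((G n).degree v : ℝ≥0) ≤ D) :
    LDGraph.LDConvergent G hD hdeg ↔
      ∀ k : ℕ, 1 ≤ k → LDGraph.KLDConvergent G hD hdeg k :=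
  ⟨fun h k hk => h.kLDConvergent k hk, LDGraph.LDConvergent.of_kLDConvergent⟩
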